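/- Let $d\ge 1$ and let $f_0:\mathbb R^d\to[0,\infty)$ be a probability density (with respect to Lebesgue measure) that vanishes outside $[0,1]^d$; let $\mathcal P_0$ be the distribution with density $f_0$, let $f_1=\mathbf 1_{[0,1]^d}$ be the uniform density, and let $A=\{x: f_0(x)>0\}$ be the support of $f_0$. Define the p-value $$p(\eta)=\mathcal P_0\Big(x:\ \frac{f_1(x)}{f_0(x)}\ \ge\ \frac{f_1(\eta)}{f_0(\eta)}\Big),\qquad \eta\in[0,1]^d,$$ where the ratio is $+\infty$ if $f_0=0<f_1$. Assume: 1. the likelihood ratio has no flat spots: $\mathcal P_0\big(x: f_1(x)/f_0(x)=c\big)=0$ for every $c\in[0,\infty]$; 2. $f_0$ is twice differentiable on the interior of $A$, and there are a real number $\lambda_M$ and a symmetric matrix $M$ with $\lambda_{\max}(M)\le\lambda_M$ such that the Hessian satisfies $H(x)\preceq M$ for all $x$ in the interior of $A$; 3. there is $\beta>0$ with $f_0(x)\ge\beta$ for all $x\in A$. Let $x_0,x_1,x_2,\dots$ be i.i.d. with density $f_0$. For $n=2m+1$ split the training set $\{x_0,\dots,x_{2m}\}$ into $S_1=\{x_0,\dots,x_m\}$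 and $S_2=\{x_{m+1},\dots,x_{2m}\}$. For $K\ge1$ let $R_{S_2}(\eta)$ be the Euclidean distance from $\eta$ to its $K$-th nearest neighbor in $S_2$, let $R_{S_1}(x_i)$ be the Euclidean distance from $x_i\in S_1$ to its $K$-th nearest neighbor in $S_1\setminus\{x_i\}$, and set $$\hat p_K(\eta)=\frac1m\sum_{x_i\in S_1}\mathbb I_{\{R_{S_2}(\eta)\le R_{S_1}(x_i)\}} .$$ Let $K=K_m$ be any sequence of integers of exact order $m^{2/5}$, that is, $c\,m^{2/5}\le K_m\le C\,m^{2/5}$ for all large $m$, with constants $0<c\le C$. Then for every $\eta\in[0,1]^d$ that does not lie on the topological boundary (in $\mathbb R^d$) of $A$, $$|\hat p_K(\eta)-p(\eta)|\longrightarrow 0\quad\text{almost surely as } n=2m+1\to\infty .$$ -/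

import Mathlib

open MeasureTheory ProbabilityTheory Filter Topology Asymptotics
open scoped ENNReal

namespace LPE

/-- The unit cube `[0,1]^d` in Euclidean space. -/
def cube (d : ℕ) : Set (EuclideanSpace ℝ (Fin d)) :=
  {x | ∀ i, x i ∈ Set.Icc (0 : ℝ) 1}

/-- `f` is a probability density (with respect to Lebesgue measure) supported in `[0,1]^d`. -/
structure IsCubeDensity {d : ℕ} (f : EuclideanSpace ℝ (Fin d) → ℝ) : Prop where
  measurable : Measurable f
  nonneg : ∀ x, 0 ≤ f x
  eq_zero_of_notMem : ∀ x, x ∉ cube d → f x = 0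
  lintegral_eq_one : ∫⁻ x, ENNReal.ofReal (f x) = 1

/-- The measure with Lebesgue density `f`. -/
noncomputable def law {d : ℕ} (f : EuclideanSpace ℝ (Fin d) → ℝ) :
    Measure (EuclideanSpace ℝ (Fin d)) :=
  volume.withDensity fun x => ENNReal.ofReal (f x)

/-- The density of the uniform distribution on `[0,1]^d`. -/
noncomputable def uniformDensity (d : ℕ) : EuclideanSpace ℝ (Fin d) → ℝ :=
  (cube d).indicator fun _ => 1

/-- The likelihood ratio `f₁ / f₀`, with value `∞` where `f₀ = 0 < f₁`. -/
noncomputable def likelihoodRatio {d : ℕ} (f₁ f₀ : EuclideanSpace ℝ (Fin d) → ℝ)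
    (x : EuclideanSpace ℝ (Fin d)) : ℝ≥0∞ :=
  ENNReal.ofReal (f₁ x) / ENNReal.ofReal (f₀ x)

/-- The likelihood ratio has no flat spots of non-zero nominal probability. -/
def NoFlatSpots {d : ℕ} (f₁ f₀ : EuclideanSpace ℝ (Fin d) → ℝ) : Prop :=
  ∀ c : ℝ≥0∞, law f₀ {x | likelihoodRatio f₁ f₀ x = c} = 0

/-- The p-value `p(η) = P₀ (x : f₁(x)/f₀(x) ≥ f₁(η)/f₀(η))`. -/
noncomputable def pValue {d : ℕ} (f₁ f₀ : EuclideanSpace ℝ (Fin d) → ℝ)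
    (η : EuclideanSpace ℝ (Fin d)) : ℝ :=
  (law f₀).real {x | likelihoodRatio f₁ f₀ η ≤ likelihoodRatio f₁ f₀ x}

/-- The Hessian matrix of `f` at `x`. -/
noncomputable def hessian {d : ℕ} (f : EuclideanSpace ℝ (Fin d) → ℝ)
    (x : EuclideanSpace ℝ (Fin d)) : Matrix (Fin d) (Fin d) ℝ :=
  Matrix.of fun i j =>
    fderiv ℝ (fderiv ℝ f) x (EuclideanSpace.single i 1) (EuclideanSpace.single j 1)

/-- `f` is twice differentiable on the open set `U`, and its Hessian is dominated on `U`, in the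
Loewner order, by a single symmetric matrix whose largest eigenvalue is at most `lam`. -/
def HessianDominatedOn {d : ℕ} (f : EuclideanSpace ℝ (Fin d) → ℝ)
    (U : Set (EuclideanSpace ℝ (Fin d))) (lam : ℝ) : Prop :=
  DifferentiableOn ℝ f U ∧ DifferentiableOn ℝ (fderiv ℝ f) U ∧
    ∃ (M : Matrix (Fin d) (Fin d) ℝ) (hM : M.IsHermitian),
      (∀ i, hM.eigenvalues i ≤ lam) ∧ ∀ x ∈ U, (M - hessian f x).PosSemidef

/-- The distance from `y` to its `K`-th nearest neighbour among the points `x j`, `j ∈ J`: the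
least radius `r` such that at least `K` of these points lie within distance `r` of `y`
(meaningful for `1 ≤ K ≤ J.card`). -/
noncomputable def knnDist {d : ℕ} (K : ℕ) (x : ℕ → EuclideanSpace ℝ (Fin d)) (J : Finset ℕ)
    (y : EuclideanSpace ℝ (Fin d)) : ℝ :=
  sInf {r : ℝ | 0 ≤ r ∧ K ≤ (J.filter fun j => dist y (x j) ≤ r).card}

/-- The split-sample K-LPE score of `η` from the `n = 2m+1` points `x 0, …, x (2m)`, with
`S₁ = {x 0, …, x m}` and `S₂ = {x (m+1), …, x (2m)}`:
`(1/m) ∑_{x i ∈ S₁} 1{R_{S₂}(η) ≤ R_{S₁}(x i)}`, where the neighbours of `x i` are sought in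
`S₁` without `x i` itself. -/
noncomputable def score {d : ℕ} (K m : ℕ) (x : ℕ → EuclideanSpace ℝ (Fin d))
    (η : EuclideanSpace ℝ (Fin d)) : ℝ :=
  (1 / (m : ℝ)) * ∑ i ∈ Finset.range (m + 1),
    {r : ℝ | knnDist K x (Finset.Ioc m (2 * m)) η ≤ r}.indicator (fun _ => (1 : ℝ))
      (knnDist K x ((Finset.range (m + 1)).erase i) (x i))

end LPE

/-
For `u > 0` let `r` be the radius of the balls of volume `K / (m u)`, so that the ball of radius
`r` about `x` is expected to contain about `K f₀(x) / u` of `m` sample points. Chernoff's bound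
and Borel–Cantelli, applied conditionally on each `x i` and available because `K` outgrows
`log m`, show that almost surely, for large `m`, the `K`-NN distance is at most `r` at all sample
points whose ball has mass well above `K / m`, and exceeds `r` at all those whose ball has mass
well below. With `u` slightly above `f₀(η)` the `K`-NN distance of `η` exceeds `r`, so the score
is at most the proportion of sample points with too little mass in their ball; by Lebesgue
differentiation and the law of large numbers this is asymptotically at most `P₀(f₀ ≤ w)` for any
`w > u`. Taking `u` slightly below `f₀(η)` gives the matching lower bound. In the absence of flat
spots `w ↦ P₀(f₀ ≤ w)` is continuous at `f₀(η)`, where its value is the p-value.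
-/

namespace LPE

section Counting

variable {ι E : Type*}

open Classical in
/-- The number of indices `j ∈ J` for which the point `x j` lies in `A`: the empirical count
through which both nearest neighbour distances and empirical frequencies are read off. -/
noncomputable def hitCount (x : ι → E) (J : Finset ι) (A : Set E) : ℕ :=
  (J.filter fun j => x j ∈ A).card

lemma hitCount_le_hitCount {F : Type*} {x : ι → E} {y : ι → F} {J : Finset ι} {A : Set E}
    {B : Set F} (h : ∀ j ∈ J, x j ∈ A → y j ∈ B) : hitCount x J A ≤ hitCount y J B := by
  classical
  refine Finset.card_le_card fun j hj => ?_
  rw [Finset.mem_filter] at hj ⊢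
  exact ⟨hj.1, h j hj.1 hj.2⟩

lemma hitCount_mono (x : ι → E) (J : Finset ι) {A B : Set E} (h : A ⊆ B) :
    hitCount x J A ≤ hitCount x J B :=
  hitCount_le_hitCount fun _ _ hj => h hj

lemma natCast_hitCount (x : ι → E) (J : Finset ι) (A : Set E) :
    (hitCount x J A : ℝ) = ∑ j ∈ J, A.indicator (fun _ => (1 : ℝ)) (x j) := by
  classical
  simp [hitCount, Set.indicator_apply]

lemma eventually_hitCount_closedBall_eq [PseudoMetricSpace E] (x : ι → E) (J : Finset ι) (y : E)
    (r : ℝ) : ∀ᶠ s in 𝓝[≥] r,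
      hitCount x J (Metric.closedBall y s) = hitCount x J (Metric.closedBall y r) := by
  classical
  have hstable : ∀ᶠ s in 𝓝 r, ∀ j ∈ J, r < dist (x j) y → s < dist (x j) y :=
    (Finset.eventually_all J).2 fun j _ => by
      by_cases hj : r < dist (x j) y
      · exact (gt_mem_nhds hj).mono fun s hs _ => hs
      · exact Eventually.of_forall fun s h => absurd h hj
  filter_upwards [nhdsWithin_le_nhds hstable, self_mem_nhdsWithin] with s hs hrs
  refine congrArg Finset.card (Finset.filter_congr fun j hj => ⟨fun h => ?_, fun h => ?_⟩)
  · exact not_lt.1 fun h' => (hs j hj h').not_ge h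
  · exact Metric.closedBall_subset_closedBall hrs h

lemma knnDist_eq_sInf_hitCount {d : ℕ} (K : ℕ) (x : ℕ → EuclideanSpace ℝ (Fin d)) (J : Finset ℕ)
    (y : EuclideanSpace ℝ (Fin d)) :
    knnDist K x J y = sInf {r | 0 ≤ r ∧ K ≤ hitCount x J (Metric.closedBall y r)} := by
  classical
  simp only [knnDist, hitCount, Metric.mem_closedBall']

lemma knnDist_le_iff {d K : ℕ} {x : ℕ → EuclideanSpace ℝ (Fin d)} {J : Finset ℕ}
    {y : EuclideanSpace ℝ (Fin d)} {r : ℝ} (hr : 0 ≤ r) (hK : K ≤ J.card) :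
    knnDist K x J y ≤ r ↔ K ≤ hitCount x J (Metric.closedBall y r) := by
  classical
  rw [knnDist_eq_sInf_hitCount]
  set R := {r | 0 ≤ r ∧ K ≤ hitCount x J (Metric.closedBall y r)}
  have hR : R.Nonempty := by
    refine ⟨∑ j ∈ J, dist (x j) y, Finset.sum_nonneg fun _ _ => dist_nonneg, hK.trans_eq ?_⟩
    refine congrArg Finset.card (Finset.filter_true_of_mem fun j hj => ?_).symm
    exact Finset.single_le_sum (f := fun j => dist (x j) y) (fun _ _ => dist_nonneg) hj
  refine ⟨fun h => ?_, fun h => csInf_le ⟨0, fun s hs => hs.1⟩ ⟨hr, h⟩⟩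
  obtain ⟨s, hrs, hs⟩ := (mem_nhdsGE_iff_exists_Ico_subset).1
    (eventually_hitCount_closedBall_eq x J y r)
  obtain ⟨t, ht, hts⟩ := exists_lt_of_csInf_lt hR (h.trans_lt hrs)
  rcases le_total r t with hrt | htr
  · exact ht.2.trans_eq (hs ⟨hrt, hts⟩)
  · exact ht.2.trans (hitCount_mono x J (Metric.closedBall_subset_closedBall htr))

end Counting

section Chernoff

variable {ι Ω E : Type*} [MeasurableSpace Ω] [MeasurableSpace E] {μ : Measure Ω}
  [IsProbabilityMeasure μ] {P : Measure E} {X : ι → Ω → E} {A : Set E}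

lemma mgf_indicator_comp_le {Y : Ω → E} (hY : HasLaw Y P μ) (hA : MeasurableSet A) (s : ℝ) :
    mgf (A.indicator (fun _ => (1 : ℝ)) ∘ Y) μ s ≤ Real.exp (P.real A * (Real.exp s - 1)) := by
  have : IsProbabilityMeasure P := hY.isProbabilityMeasure_iff.1 inferInstance
  have hexp : ∀ y, Real.exp (s * A.indicator (fun _ => (1 : ℝ)) y)
      = 1 + A.indicator (fun _ => Real.exp s - 1) y := fun y => by
    by_cases h : y ∈ A <;> simp [h]
  have hmgf : mgf (A.indicator (fun _ => (1 : ℝ)) ∘ Y) μ s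
      = 1 + P.real A * (Real.exp s - 1) := by
    calc mgf (A.indicator (fun _ => (1 : ℝ)) ∘ Y) μ s
        = ∫ y, Real.exp (s * A.indicator (fun _ => (1 : ℝ)) y) ∂P :=
          hY.integral_comp (f := fun y => Real.exp (s * A.indicator (fun _ => (1 : ℝ)) y))
            (((measurable_const.indicator hA).const_mul s).exp.aestronglyMeasurable)
      _ = 1 + P.real A * (Real.exp s - 1) := by
          simp only [hexp]
          rw [integral_add (integrable_const _) ((integrable_const _).indicator hA),
            integral_indicator_const _ hA]
          simp
  rw [hmgf, add_comm]
  exact Real.add_one_le_exp _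

omit [IsProbabilityMeasure μ] in
lemma aemeasurable_hitCount (hX : ∀ i, HasLaw (X i) P μ) (hA : MeasurableSet A) (J : Finset ι) :
    AEMeasurable (fun ω => (hitCount (fun j => X j ω) J A : ℝ)) μ := by
  simp only [natCast_hitCount]
  exact Finset.aemeasurable_fun_sum J fun j _ =>
    (measurable_const.indicator hA).comp_aemeasurable (hX j).aemeasurable

lemma integrable_exp_mul_hitCount (hX : ∀ i, HasLaw (X i) P μ) (hA : MeasurableSet A)
    (J : Finset ι) (s : ℝ) :
    Integrable (fun ω => Real.exp (s * hitCount (fun j => X j ω) J A)) μ := by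
  classical
  refine integrable_exp_mul_of_mem_Icc (a := 0) (b := J.card) (aemeasurable_hitCount hX hA J)
    (Eventually.of_forall fun ω => ⟨by positivity, ?_⟩)
  exact_mod_cast Finset.card_filter_le J _

lemma mgf_hitCount_le (hind : iIndepFun X μ) (hX : ∀ i, HasLaw (X i) P μ) (hA : MeasurableSet A)
    (J : Finset ι) (s : ℝ) :
    mgf (fun ω => (hitCount (fun j => X j ω) J A : ℝ)) μ s
      ≤ Real.exp (J.card * P.real A * (Real.exp s - 1)) := by
  have hm : Measurable (A.indicator fun _ => (1 : ℝ)) := measurable_const.indicator hA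
  have hsum : (fun ω => (hitCount (fun j => X j ω) J A : ℝ))
      = ∑ j ∈ J, A.indicator (fun _ => (1 : ℝ)) ∘ X j := by
    ext ω
    simp [natCast_hitCount]
  calc mgf (fun ω => (hitCount (fun j => X j ω) J A : ℝ)) μ s
      = ∏ j ∈ J, mgf (A.indicator (fun _ => (1 : ℝ)) ∘ X j) μ s := by
        rw [hsum, (hind.comp _ fun _ => hm).mgf_sum₀
          (fun j => hm.comp_aemeasurable (hX j).aemeasurable) J]
    _ ≤ ∏ _j ∈ J, Real.exp (P.real A * (Real.exp s - 1)) :=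
        Finset.prod_le_prod (fun _ _ => mgf_nonneg) fun j _ => mgf_indicator_comp_le (hX j) hA s
    _ = Real.exp (J.card * P.real A * (Real.exp s - 1)) := by
        rw [Finset.prod_const, ← Real.exp_nat_mul, mul_assoc]

/-- The exponential rate in Chernoff's bound for a binomial count of mean `θ * k` to reach `k`,
i.e. the relative entropy of the Poisson law of mean `1` with respect to that of mean `θ`. It
serves both tails. -/
noncomputable def chernoffRate (θ : ℝ) : ℝ := θ - 1 - Real.log θ

lemma chernoffRate_pos {θ : ℝ} (hθ : 0 < θ) (hθ1 : θ ≠ 1) : 0 < chernoffRate θ :=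
  sub_pos.2 (Real.log_lt_sub_one_of_pos hθ hθ1)

lemma measureReal_le_hitCount_le (hind : iIndepFun X μ) (hX : ∀ i, HasLaw (X i) P μ)
    (hA : MeasurableSet A) {J : Finset ι} {θ k : ℝ} (hθ : 0 < θ) (hθ1 : θ ≤ 1)
    (hle : J.card * P.real A ≤ θ * k) :
    μ.real {ω | k ≤ hitCount (fun j => X j ω) J A} ≤ Real.exp (-chernoffRate θ * k) := by
  have hexp : Real.exp (-Real.log θ) - 1 = θ⁻¹ - 1 := by rw [Real.exp_neg, Real.exp_log hθ]
  have hnonneg : 0 ≤ θ⁻¹ - 1 := sub_nonneg.2 ((one_le_inv₀ hθ).2 hθ1)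
  calc μ.real {ω | k ≤ hitCount (fun j => X j ω) J A}
      ≤ Real.exp (-(-Real.log θ) * k)
        * mgf (fun ω => (hitCount (fun j => X j ω) J A : ℝ)) μ (-Real.log θ) :=
        measure_ge_le_exp_mul_mgf k (neg_nonneg.2 (Real.log_nonpos hθ.le hθ1))
          (integrable_exp_mul_hitCount hX hA J _)
    _ ≤ Real.exp (-(-Real.log θ) * k) * Real.exp (θ * k * (θ⁻¹ - 1)) := by
        grw [mgf_hitCount_le hind hX hA J, hexp, hle]
    _ = Real.exp (-chernoffRate θ * k) := by
        rw [← Real.exp_add, chernoffRate]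
        congr 1
        field_simp
        ring

lemma measureReal_hitCount_le_le (hind : iIndepFun X μ) (hX : ∀ i, HasLaw (X i) P μ)
    (hA : MeasurableSet A) {J : Finset ι} {θ k : ℝ} (hθ : 1 ≤ θ)
    (hle : θ * k ≤ J.card * P.real A) :
    μ.real {ω | hitCount (fun j => X j ω) J A ≤ k} ≤ Real.exp (-chernoffRate θ * k) := by
  have hθ0 : 0 < θ := one_pos.trans_le hθ
  have hexp : Real.exp (-Real.log θ) - 1 = θ⁻¹ - 1 := by rw [Real.exp_neg, Real.exp_log hθ0]
  have hnonpos : θ⁻¹ - 1 ≤ 0 := sub_nonpos.2 (inv_le_one_of_one_le₀ hθ)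
  calc μ.real {ω | hitCount (fun j => X j ω) J A ≤ k}
      ≤ Real.exp (-(-Real.log θ) * k)
        * mgf (fun ω => (hitCount (fun j => X j ω) J A : ℝ)) μ (-Real.log θ) :=
        measure_le_le_exp_mul_mgf k (neg_nonpos.2 (Real.log_nonneg hθ))
          (integrable_exp_mul_hitCount hX hA J _)
    _ ≤ Real.exp (-(-Real.log θ) * k) * Real.exp (θ * k * (θ⁻¹ - 1)) := by
        grw [mgf_hitCount_le hind hX hA J, hexp]
        gcongr Real.exp _ * Real.exp ?_
        exact mul_le_mul_of_nonpos_right hle hnonpos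
    _ = Real.exp (-chernoffRate θ * k) := by
        rw [← Real.exp_add, chernoffRate]
        congr 1
        field_simp
        ring

end Chernoff

section Independence

variable {ι Ω E F : Type*} [MeasurableSpace Ω] [MeasurableSpace E] [MeasurableSpace F]
  {μ : Measure Ω} [IsProbabilityMeasure μ]

lemma measure_prodMk_mem_le {Y : Ω → E} {Z : Ω → F} (hY : AEMeasurable Y μ)
    (hZ : AEMeasurable Z μ) (h : Y ⟂ᵢ[μ] Z) {B : Set (E × F)} (hB : MeasurableSet B) {c : ℝ≥0∞}
    (hc : ∀ y, μ {ω | (y, Z ω) ∈ B} ≤ c) :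
    μ {ω | (Y ω, Z ω) ∈ B} ≤ c := by
  have : IsProbabilityMeasure (μ.map Y) := Measure.isProbabilityMeasure_map hY
  have hslice : ∀ y, μ.map Z (Prod.mk y ⁻¹' B) ≤ c := fun y => by
    rw [Measure.map_apply_of_aemeasurable hZ (measurable_prodMk_left hB)]
    exact hc y
  calc μ {ω | (Y ω, Z ω) ∈ B}
      = μ.map (fun ω => (Y ω, Z ω)) B :=
        (Measure.map_apply_of_aemeasurable (hY.prodMk hZ) hB).symm
    _ = ∫⁻ y, μ.map Z (Prod.mk y ⁻¹' B) ∂μ.map Y := by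
        rw [(indepFun_iff_map_prod_eq_prod_map_map hY hZ).1 h, Measure.prod_apply hB]
    _ ≤ ∫⁻ _y, c ∂μ.map Y := lintegral_mono hslice
    _ = c := by simp

lemma measureReal_mem_and_hitCount_mem_le {X : ι → Ω → E} (hX : ∀ i, AEMeasurable (X i) μ)
    (hind : iIndepFun X μ) {S : E → Set E} (hS : MeasurableSet {p : E × E | p.2 ∈ S p.1})
    {D : Set E} (hD : MeasurableSet D) (T : Set ℕ) {J : Finset ι} {i : ι} (hi : i ∉ J) {c : ℝ}
    (hc0 : 0 ≤ c) (hc : ∀ y ∈ D, μ.real {ω | hitCount (fun j => X j ω) J (S y) ∈ T} ≤ c) :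
    μ.real {ω | X i ω ∈ D ∧ hitCount (fun j => X j ω) J (S (X i ω)) ∈ T} ≤ c := by
  classical
  have hXJ : X i ⟂ᵢ[μ] fun ω (j : J) => X j ω :=
    (hind.indepFun_finset₀ {i} J (Finset.disjoint_singleton_left.2 hi) hX).comp
      (measurable_pi_apply (⟨i, Finset.mem_singleton_self i⟩ : ({i} : Finset ι))) measurable_id
  let N : E × (J → E) → ℕ := fun p => ∑ j : J, if p.2 j ∈ S p.1 then 1 else 0
  have hN : Measurable N := by
    refine Finset.measurable_sum _ fun j _ => Measurable.ite ?_ measurable_const measurable_const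
    have hpair : Measurable fun p : E × (J → E) => (p.1, p.2 j) := by fun_prop
    exact hpair hS
  have hNcount : ∀ y ω, N (y, fun j : J => X j ω) = hitCount (fun j => X j ω) J (S y) := by
    intro y ω
    rw [hitCount, Finset.card_filter, ← Finset.sum_coe_sort J]
  simp only [← hNcount] at hc ⊢
  refine ENNReal.toReal_le_of_le_ofReal hc0 (measure_prodMk_mem_le (hX i)
    (aemeasurable_pi_lambda (fun ω (j : J) => X j ω) fun j => hX j) hXJ
    (B := {p | p.1 ∈ D ∧ N p ∈ T}) ((measurable_fst hD).inter (hN T.to_countable.measurableSet))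
    fun y => ?_)
  rw [ENNReal.le_ofReal_iff_toReal_le (measure_ne_top _ _) hc0]
  by_cases hy : y ∈ D
  · simpa [hy, measureReal_def] using hc y hy
  · simpa [hy] using hc0

end Independence

section BorelCantelli

lemma summable_succ_mul_exp_neg {k : ℕ → ℕ}
    (hk : (fun m : ℕ => Real.log m) =o[atTop] fun m => (k m : ℝ)) {c : ℝ} (hc : 0 < c) :
    Summable fun m : ℕ => ((m : ℝ) + 1) * Real.exp (-c * k m) := by
  refine Summable.of_norm_bounded_eventually_nat (g := fun m : ℕ => 2 * (m : ℝ) ^ (-2 : ℝ))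
    ((Real.summable_nat_rpow.2 (by norm_num)).mul_left 2) ?_
  filter_upwards [hk.bound (c := c / 3) (by positivity), eventually_ge_atTop 1] with m hm hm1
  have hm1' : (1 : ℝ) ≤ m := by exact_mod_cast hm1
  have hm0 : (0 : ℝ) < m := by positivity
  rw [Real.norm_of_nonneg (Real.log_nonneg hm1'), Real.norm_of_nonneg (Nat.cast_nonneg (k m))] at hm
  calc ‖((m : ℝ) + 1) * Real.exp (-c * k m)‖
      = ((m : ℝ) + 1) * Real.exp (-c * k m) := Real.norm_of_nonneg (by positivity)
    _ ≤ (2 * m) * Real.exp (Real.log m * (-3)) := by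
        gcongr ?_ * Real.exp ?_ <;> linarith
    _ = 2 * ((m : ℝ) ^ (1 : ℝ) * (m : ℝ) ^ (-3 : ℝ)) := by
        rw [← Real.rpow_def_of_pos hm0, Real.rpow_one, mul_assoc]
    _ = 2 * (m : ℝ) ^ (-2 : ℝ) := by
        rw [← Real.rpow_add hm0]
        norm_num

lemma summable_exp_neg {k : ℕ → ℕ}
    (hk : (fun m : ℕ => Real.log m) =o[atTop] fun m => (k m : ℝ)) {c : ℝ} (hc : 0 < c) :
    Summable fun m => Real.exp (-c * k m) :=
  (summable_succ_mul_exp_neg hk hc).of_nonneg_of_le (fun _ => by positivity) fun m =>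
    le_mul_of_one_le_left (Real.exp_pos _).le (by simp)

lemma ae_eventually_notMem_of_summable {Ω : Type*} [MeasurableSpace Ω] {μ : Measure Ω}
    [IsFiniteMeasure μ] {s : ℕ → Set Ω} {b : ℕ → ℝ}
    (hb : Summable b) (h : ∀ᶠ m in atTop, μ.real (s m) ≤ b m) :
    ∀ᵐ ω ∂μ, ∀ᶠ m in atTop, ω ∉ s m := by
  have hs : Summable fun m => μ.real (s m) :=
    hb.of_norm_bounded_eventually_nat <| h.mono fun m hm => by
      rwa [Real.norm_of_nonneg measureReal_nonneg]
  exact ae_eventually_notMem (by simpa using hs.tsum_ofReal_ne_top)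

end BorelCantelli

section Deviations

variable {Ω E : Type*} [MeasurableSpace Ω] [MeasurableSpace E] {μ : Measure Ω}
  [IsProbabilityMeasure μ] {P : Measure E} {k : ℕ → ℕ} {θ : ℝ}

section FixedSets

variable {ι : Type*} {X : ι → Ω → E} {J : ℕ → Finset ι} {A : ℕ → Set E}

lemma ae_eventually_hitCount_lt (hind : iIndepFun X μ) (hX : ∀ i, HasLaw (X i) P μ)
    (hk : (fun m : ℕ => Real.log m) =o[atTop] fun m => (k m : ℝ)) (hA : ∀ m, MeasurableSet (A m))
    (hθ : 0 < θ) (hθ1 : θ < 1) (hle : ∀ᶠ m in atTop, (J m).card * P.real (A m) ≤ θ * k m) :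
    ∀ᵐ ω ∂μ, ∀ᶠ m in atTop, hitCount (fun i => X i ω) (J m) (A m) < k m := by
  have h := ae_eventually_notMem_of_summable (summable_exp_neg hk (chernoffRate_pos hθ hθ1.ne))
    (hle.mono fun m hm => measureReal_le_hitCount_le hind hX (hA m) hθ hθ1.le hm)
  simpa using h

lemma ae_eventually_le_hitCount (hind : iIndepFun X μ) (hX : ∀ i, HasLaw (X i) P μ)
    (hk : (fun m : ℕ => Real.log m) =o[atTop] fun m => (k m : ℝ)) (hA : ∀ m, MeasurableSet (A m))
    (hθ : 1 < θ) (hle : ∀ᶠ m in atTop, θ * k m ≤ (J m).card * P.real (A m)) :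
    ∀ᵐ ω ∂μ, ∀ᶠ m in atTop, k m ≤ hitCount (fun i => X i ω) (J m) (A m) := by
  have h := ae_eventually_notMem_of_summable
    (summable_exp_neg hk (chernoffRate_pos (one_pos.trans hθ) hθ.ne'))
    (hle.mono fun m hm => measureReal_hitCount_le_le hind hX (hA m) hθ.le hm)
  filter_upwards [h] with ω hω
  filter_upwards [hω] with m hm
  exact_mod_cast (not_le.1 hm).le

end FixedSets

section CentredSets

variable {X : ℕ → Ω → E} {S : ℕ → E → Set E}

lemma ae_eventually_forall_hitCount_notMem (hind : iIndepFun X μ)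
    (hX : ∀ i, AEMeasurable (X i) μ) (hk : (fun m : ℕ => Real.log m) =o[atTop] fun m => (k m : ℝ))
    (hS : ∀ m, MeasurableSet {p : E × E | p.2 ∈ S m p.1}) {D : ℕ → Set E}
    (hD : ∀ m, MeasurableSet (D m)) (T : ℕ → Set ℕ) {c : ℝ} (hc : 0 < c)
    (h : ∀ m, ∀ y ∈ D m, ∀ J : Finset ℕ, J.card = m →
      μ.real {ω | hitCount (fun j => X j ω) J (S m y) ∈ T m} ≤ Real.exp (-c * k m)) :
    ∀ᵐ ω ∂μ, ∀ᶠ m in atTop, ∀ i ∈ Finset.range (m + 1), X i ω ∈ D m →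
      hitCount (fun j => X j ω) ((Finset.range (m + 1)).erase i) (S m (X i ω)) ∉ T m := by
  let bad : ℕ → ℕ → Set Ω := fun m i => {ω | X i ω ∈ D m ∧
    hitCount (fun j => X j ω) ((Finset.range (m + 1)).erase i) (S m (X i ω)) ∈ T m}
  have hunion : ∀ m, μ.real (⋃ i ∈ Finset.range (m + 1), bad m i)
      ≤ ((m : ℝ) + 1) * Real.exp (-c * k m) := fun m => calc
    _ ≤ ∑ i ∈ Finset.range (m + 1), μ.real (bad m i) := measureReal_biUnion_finset_le _ _
    _ ≤ ∑ _i ∈ Finset.range (m + 1), Real.exp (-c * k m) :=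
        Finset.sum_le_sum fun i hi => measureReal_mem_and_hitCount_mem_le hX hind (hS m) (hD m)
          (T m) (Finset.notMem_erase i _) (Real.exp_pos _).le fun y hy =>
            h m y hy _ (by simp [Finset.card_erase_of_mem hi])
    _ = ((m : ℝ) + 1) * Real.exp (-c * k m) := by simp
  filter_upwards [ae_eventually_notMem_of_summable (summable_succ_mul_exp_neg hk hc)
    (Eventually.of_forall hunion)] with ω hω
  filter_upwards [hω] with m hm i hi hiD hiT
  exact hm (Set.mem_biUnion hi ⟨hiD, hiT⟩)

lemma ae_eventually_forall_hitCount_lt (hind : iIndepFun X μ) (hX : ∀ i, HasLaw (X i) P μ)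
    (hk : (fun m : ℕ => Real.log m) =o[atTop] fun m => (k m : ℝ))
    (hS : ∀ m, MeasurableSet {p : E × E | p.2 ∈ S m p.1}) (hθ : 0 < θ) (hθ1 : θ < 1) :
    ∀ᵐ ω ∂μ, ∀ᶠ m in atTop, ∀ i ∈ Finset.range (m + 1), m * P.real (S m (X i ω)) ≤ θ * k m →
      hitCount (fun j => X j ω) ((Finset.range (m + 1)).erase i) (S m (X i ω)) < k m := by
  have : IsProbabilityMeasure P := (hX 0).isProbabilityMeasure_iff.1 inferInstance
  have h := ae_eventually_forall_hitCount_notMem hind (fun i => (hX i).aemeasurable) hk hS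
    (D := fun m => {x | m * P.real (S m x) ≤ θ * k m})
    (fun m => measurableSet_le
      ((measurable_measure_prodMk_left (hS m)).ennreal_toReal.const_mul _) measurable_const)
    (fun m => Set.Ici (k m)) (chernoffRate_pos hθ hθ1.ne) ?_
  · simpa using h
  rintro _ y hy J rfl
  simpa using measureReal_le_hitCount_le hind hX (measurable_prodMk_left (hS J.card)) hθ hθ1.le hy

lemma ae_eventually_forall_le_hitCount (hind : iIndepFun X μ) (hX : ∀ i, HasLaw (X i) P μ)
    (hk : (fun m : ℕ => Real.log m) =o[atTop] fun m => (k m : ℝ))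
    (hS : ∀ m, MeasurableSet {p : E × E | p.2 ∈ S m p.1}) (hθ : 1 < θ) :
    ∀ᵐ ω ∂μ, ∀ᶠ m in atTop, ∀ i ∈ Finset.range (m + 1), θ * k m ≤ m * P.real (S m (X i ω)) →
      k m ≤ hitCount (fun j => X j ω) ((Finset.range (m + 1)).erase i) (S m (X i ω)) := by
  have : IsProbabilityMeasure P := (hX 0).isProbabilityMeasure_iff.1 inferInstance
  have h := ae_eventually_forall_hitCount_notMem hind (fun i => (hX i).aemeasurable) hk hS
    (D := fun m => {x | θ * k m ≤ m * P.real (S m x)})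
    (fun m => measurableSet_le measurable_const
      ((measurable_measure_prodMk_left (hS m)).ennreal_toReal.const_mul _))
    (fun m => Set.Iio (k m)) (chernoffRate_pos (one_pos.trans hθ) hθ.ne') ?_
  · simpa using h
  rintro _ y hy J rfl
  refine (measureReal_mono fun ω hω => ?_).trans
    (measureReal_hitCount_le_le hind hX (measurable_prodMk_left (hS J.card)) hθ.le hy)
  exact Nat.cast_le (α := ℝ).2 (Set.mem_Iio.1 hω).le

end CentredSets

end Deviations

section Frequencies

lemma tendsto_succ_div {a : ℕ → ℝ} {l : ℝ} (h : Tendsto (fun n => a n / n) atTop (𝓝 l)) :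
    Tendsto (fun n => a (n + 1) / n) atTop (𝓝 l) := by
  have hratio : Tendsto (fun n : ℕ => ((n + 1 : ℕ) : ℝ) / n) atTop (𝓝 1) := by
    have h1 := (tendsto_const_nhds (x := (1 : ℝ))).add tendsto_one_div_atTop_nhds_zero_nat
    rw [add_zero] at h1
    refine h1.congr' ?_
    filter_upwards [eventually_ne_atTop 0] with n hn
    push_cast
    field_simp
  have hprod := ((tendsto_add_atTop_iff_nat 1).2 h).mul hratio
  rw [mul_one] at hprod
  refine hprod.congr fun n => ?_
  field_simp

variable {Ω E : Type*} [MeasurableSpace Ω] [MeasurableSpace E] {μ : Measure Ω}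
  [IsProbabilityMeasure μ] {P : Measure E} {X : ℕ → Ω → E}

lemma ae_tendsto_hitCount_div (hind : iIndepFun X μ) (hX : ∀ i, HasLaw (X i) P μ) {A : Set E}
    (hA : MeasurableSet A) :
    ∀ᵐ ω ∂μ, Tendsto (fun m : ℕ => (hitCount (fun i => X i ω) (Finset.range m) A : ℝ) / m) atTop
      (𝓝 (P.real A)) := by
  have : IsProbabilityMeasure P := (hX 0).isProbabilityMeasure_iff.1 inferInstance
  have hm : Measurable (A.indicator fun _ => (1 : ℝ)) := measurable_const.indicator hA
  have hmean : ∫ ω, (A.indicator (fun _ => (1 : ℝ)) ∘ X 0) ω ∂μ = P.real A := by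
    rw [(hX 0).integral_comp hm.aestronglyMeasurable, integral_indicator_const _ hA, smul_eq_mul,
      mul_one]
  have hslln := strong_law_ae_real (fun i => A.indicator (fun _ => (1 : ℝ)) ∘ X i)
    (Integrable.of_mem_Icc 0 1 (hm.comp_aemeasurable (hX 0).aemeasurable)
      (Eventually.of_forall fun ω => ⟨Set.indicator_nonneg (fun _ _ => zero_le_one) _,
        Set.indicator_le_self' (f := fun _ => (1 : ℝ)) (fun _ _ => zero_le_one) _⟩))
    (fun i j hij => (hind.indepFun hij).comp hm hm) fun i => ((hX i).identDistrib (hX 0)).comp hm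
  rw [hmean] at hslln
  simpa only [natCast_hitCount, Function.comp_apply] using hslln

lemma ae_eventually_hitCount_div_lt (hind : iIndepFun X μ) (hX : ∀ i, HasLaw (X i) P μ)
    {D : ℕ → Set E} (hD : ∀ m, MeasurableSet (D m)) {t : ℝ}
    (ht : P.real {x | ∃ᶠ m in atTop, x ∈ D m} < t) :
    ∀ᵐ ω ∂μ, ∀ᶠ m in atTop,
      (hitCount (fun i => X i ω) (Finset.range (m + 1)) (D m) : ℝ) / m < t := by
  have : IsProbabilityMeasure P := (hX 0).isProbabilityMeasure_iff.1 inferInstance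
  let U : ℕ → Set E := fun M => ⋃ m ≥ M, D m
  have hU : ∀ M, MeasurableSet (U M) := fun M =>
    MeasurableSet.biUnion (Set.to_countable _) fun m _ => hD m
  have hanti : Antitone U := fun M N hMN => Set.biUnion_subset_biUnion_left fun m hm => hMN.trans hm
  have hlim : Tendsto (fun M => P.real (U M)) atTop (𝓝 (P.real {x | ∃ᶠ m in atTop, x ∈ D m})) := by
    have hInter : ⋂ M, U M = {x | ∃ᶠ m in atTop, x ∈ D m} := by
      ext x
      simp [U, frequently_atTop]
    rw [← hInter]
    exact (ENNReal.tendsto_toReal (measure_ne_top P _)).comp (tendsto_measure_iInter_atTop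
      (fun M => (hU M).nullMeasurableSet) hanti ⟨0, measure_ne_top _ _⟩)
  obtain ⟨M, hM⟩ := (hlim.eventually_lt_const ht).exists
  filter_upwards [ae_tendsto_hitCount_div hind hX (hU M)] with ω hω
  filter_upwards [(tendsto_succ_div hω).eventually_lt_const hM, eventually_ge_atTop M] with m hm hMm
  refine lt_of_le_of_lt ?_ hm
  gcongr
  exact hitCount_mono _ _ (Set.subset_biUnion_of_mem (u := D) hMm)

lemma ae_eventually_lt_hitCount_div (hind : iIndepFun X μ) (hX : ∀ i, HasLaw (X i) P μ)
    {D : ℕ → Set E} (hD : ∀ m, MeasurableSet (D m)) {t : ℝ}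
    (ht : t < P.real {x | ∀ᶠ m in atTop, x ∈ D m}) :
    ∀ᵐ ω ∂μ, ∀ᶠ m in atTop,
      t < (hitCount (fun i => X i ω) (Finset.range (m + 1)) (D m) : ℝ) / m := by
  have : IsProbabilityMeasure P := (hX 0).isProbabilityMeasure_iff.1 inferInstance
  let I : ℕ → Set E := fun M => ⋂ m ≥ M, D m
  have hI : ∀ M, MeasurableSet (I M) := fun M =>
    MeasurableSet.biInter (Set.to_countable _) fun m _ => hD m
  have hmono : Monotone I := fun M N hMN => Set.biInter_subset_biInter_left fun m hm => hMN.trans hm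
  have hlim : Tendsto (fun M => P.real (I M)) atTop (𝓝 (P.real {x | ∀ᶠ m in atTop, x ∈ D m})) := by
    have hUnion : ⋃ M, I M = {x | ∀ᶠ m in atTop, x ∈ D m} := by
      ext x
      simp [I, eventually_atTop]
    rw [← hUnion]
    exact (ENNReal.tendsto_toReal (measure_ne_top P _)).comp (tendsto_measure_iUnion_atTop hmono)
  obtain ⟨M, hM⟩ := (hlim.eventually_const_lt ht).exists
  filter_upwards [ae_tendsto_hitCount_div hind hX (hI M)] with ω hω
  filter_upwards [(tendsto_succ_div hω).eventually_const_lt hM, eventually_ge_atTop M] with m hm hMm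
  refine hm.trans_le ?_
  gcongr
  exact hitCount_mono _ _ (Set.biInter_subset_of_mem (t := D) hMm)

end Frequencies

section BallDensity

/-- `ν` has Lebesgue density `a` at `x` along closed balls centred at `x`: the pointwise notion of
density in Lebesgue's differentiation theorem. The quotient is of real numbers, so both measures
should be finite on small balls. -/
def HasBallDensityAt {E : Type*} [PseudoMetricSpace E] [MeasureSpace E] (ν : Measure E) (x : E)
    (a : ℝ) : Prop :=
  Tendsto (fun r => ν.real (Metric.closedBall x r) / volume.real (Metric.closedBall x r))
    (𝓝[>] 0) (𝓝 a)

variable {d : ℕ} {f : EuclideanSpace ℝ (Fin d) → ℝ}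

lemma ae_law_pos (hf : Measurable f) : ∀ᵐ x ∂law f, 0 < f x := by
  rw [law, ae_withDensity_iff hf.ennreal_ofReal]
  exact Eventually.of_forall fun x hx => ENNReal.ofReal_pos.1 (pos_iff_ne_zero.2 hx)

lemma ae_hasBallDensityAt_law [IsFiniteMeasure (law f)] (hf : Measurable f) :
    ∀ᵐ x ∂law f, HasBallDensityAt (law f) x (f x) := by
  have hac : law f ≪ volume := withDensity_absolutelyContinuous _ _
  filter_upwards [hac.ae_le (Besicovitch.ae_tendsto_rnDeriv (law f) volume),
    hac.ae_le (Measure.rnDeriv_withDensity volume hf.ennreal_ofReal), ae_law_pos hf]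
    with x hx hrn hpos
  have hrn' : (law f).rnDeriv volume x = ENNReal.ofReal (f x) := hrn
  rw [hrn'] at hx
  have hreal := (ENNReal.tendsto_toReal ENNReal.ofReal_ne_top).comp hx
  rw [ENNReal.toReal_ofReal hpos.le] at hreal
  exact hreal.congr fun r => ENNReal.toReal_div _ _

lemma hasBallDensityAt_law_of_continuousAt (hf : Measurable f) (hnonneg : ∀ x, 0 ≤ f x)
    {x : EuclideanSpace ℝ (Fin d)} (hx : ContinuousAt f x) :
    HasBallDensityAt (law f) x (f x) := by
  have hint : ∀ r, ∫ y in Metric.closedBall x r, f y = (law f).real (Metric.closedBall x r) := by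
    intro r
    rw [integral_eq_lintegral_of_nonneg_ae (Eventually.of_forall hnonneg)
      hf.aestronglyMeasurable, measureReal_def, law,
      withDensity_apply _ Metric.isClosed_closedBall.measurableSet]
  have hsmall : Tendsto (Metric.closedBall x) (𝓝[>] 0) (𝓝 x).smallSets :=
    (tendsto_closedBall_smallSets x).mono_left nhdsWithin_le_nhds
  have hpos : ∀ᶠ r in 𝓝[>] (0 : ℝ), volume.real (Metric.closedBall x r) ≠ 0 := by
    filter_upwards [self_mem_nhdsWithin] with r hr
    exact (ENNReal.toReal_pos (Metric.measure_closedBall_pos _ _ hr).ne'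
      measure_closedBall_lt_top.ne).ne'
  have ho := hx.integral_sub_linear_isLittleO_ae (μ := volume)
    hf.stronglyMeasurable.stronglyMeasurableAtFilter hsmall
  have h := (ho.tendsto_div_nhds_zero).add_const (f x)
  rw [zero_add] at h
  refine h.congr' (hpos.mono fun r hr => ?_)
  rw [hint, smul_eq_mul]
  field_simp
  ring

lemma exists_radius_volumeReal_closedBall (hd : d ≠ 0) {v : ℕ → ℝ} (hv : Tendsto v atTop (𝓝 0))
    (hv0 : ∀ m, 0 ≤ v m) :
    ∃ r : ℕ → ℝ, Tendsto r atTop (𝓝 0) ∧ (∀ m, 0 ≤ r m) ∧ (∀ m, 0 < v m → 0 < r m) ∧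
      ∀ m (x : EuclideanSpace ℝ (Fin d)), volume.real (Metric.closedBall x (r m)) = v m := by
  set w : ℝ := volume.real (Metric.ball (0 : EuclideanSpace ℝ (Fin d)) 1) with hw
  have hw0 : 0 < w := ENNReal.toReal_pos (Metric.measure_ball_pos _ _ one_pos).ne'
    measure_ball_lt_top.ne
  have hd' : (0 : ℝ) < (d : ℝ)⁻¹ := by positivity
  have hvw : ∀ m, 0 ≤ v m / w := fun m => div_nonneg (hv0 m) hw0.le
  refine ⟨fun m => (v m / w) ^ (d : ℝ)⁻¹, ?_, fun m => Real.rpow_nonneg (hvw m) _,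
    fun m hm => Real.rpow_pos_of_pos (div_pos hm hw0) _, fun m x => ?_⟩
  · simpa [hd] using (hv.div_const w).rpow_const (p := (d : ℝ)⁻¹) (Or.inr hd'.le)
  · rw [measureReal_def, Measure.addHaar_closedBall _ _ (Real.rpow_nonneg (hvw m) _),
      ENNReal.toReal_mul, ← measureReal_def, ← hw,
      ENNReal.toReal_ofReal (pow_nonneg (Real.rpow_nonneg (hvw m) _) _),
      finrank_euclideanSpace_fin, Real.rpow_inv_natCast_pow (hvw m) hd]
    field_simp

lemma exists_radius_tendsto_mul_measureReal_div (hd : d ≠ 0) {k : ℕ → ℕ}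
    (hk : (fun m => (k m : ℝ)) =o[atTop] fun m : ℕ => (m : ℝ)) (hk0 : ∀ᶠ m in atTop, 0 < (k m : ℝ))
    {u : ℝ} (hu : 0 < u) :
    ∃ r : ℕ → ℝ, (∀ m, 0 ≤ r m) ∧
      ∀ (ν : Measure (EuclideanSpace ℝ (Fin d))) (x : EuclideanSpace ℝ (Fin d)) (a : ℝ),
        HasBallDensityAt ν x a →
        Tendsto (fun m => m * ν.real (Metric.closedBall x (r m)) / k m) atTop (𝓝 (a / u)) := by
  obtain ⟨r, hr, hr0, hrpos, hvol⟩ := exists_radius_volumeReal_closedBall hd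
    (v := fun m => k m / m / u) (by simpa using hk.tendsto_div_nhds_zero.div_const u)
    (fun m => by positivity)
  refine ⟨r, hr0, fun ν x a h => ?_⟩
  have hpos : ∀ᶠ m : ℕ in atTop, 0 < (k m : ℝ) ∧ 0 < m := hk0.and (eventually_gt_atTop 0)
  have hr' : Tendsto r atTop (𝓝[>] 0) :=
    tendsto_nhdsWithin_iff.2 ⟨hr, hpos.mono fun m ⟨hkm, hm⟩ => hrpos m (by positivity)⟩
  refine ((h.comp hr').div_const u).congr' (hpos.mono fun m ⟨hkm, hm⟩ => ?_)
  simp only [Function.comp_apply, hvol]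
  field_simp

end BallDensity

section Score

variable {d K m : ℕ} {x : ℕ → EuclideanSpace ℝ (Fin d)} {η : EuclideanSpace ℝ (Fin d)} {r : ℝ}
  {D : Set (EuclideanSpace ℝ (Fin d))}

lemma score_eq_hitCount_div (K m : ℕ) (x : ℕ → EuclideanSpace ℝ (Fin d))
    (η : EuclideanSpace ℝ (Fin d)) :
    score K m x η = (hitCount (fun i => knnDist K x ((Finset.range (m + 1)).erase i) (x i))
      (Finset.range (m + 1)) (Set.Ici (knnDist K x (Finset.Ioc m (2 * m)) η)) : ℝ) / m := by
  rw [score, natCast_hitCount, one_div, inv_mul_eq_div]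
  rfl

lemma score_nonneg (K m : ℕ) (x : ℕ → EuclideanSpace ℝ (Fin d)) (η : EuclideanSpace ℝ (Fin d)) :
    0 ≤ score K m x η := by
  rw [score_eq_hitCount_div]
  positivity

lemma card_Ioc_two_mul (m : ℕ) : (Finset.Ioc m (2 * m)).card = m := by
  rw [Nat.card_Ioc]
  lia

lemma knnDist_range_erase_le_iff (hr : 0 ≤ r) (hK : K ≤ m) {i : ℕ}
    (hi : i ∈ Finset.range (m + 1)) :
    knnDist K x ((Finset.range (m + 1)).erase i) (x i) ≤ r ↔
      K ≤ hitCount x ((Finset.range (m + 1)).erase i) (Metric.closedBall (x i) r) :=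
  knnDist_le_iff hr (by simpa [Finset.card_erase_of_mem hi] using hK)

lemma score_le_hitCount_div (hr : 0 ≤ r) (hK : K ≤ m)
    (hη : hitCount x (Finset.Ioc m (2 * m)) (Metric.closedBall η r) < K)
    (hD : ∀ i ∈ Finset.range (m + 1), x i ∉ D →
      K ≤ hitCount x ((Finset.range (m + 1)).erase i) (Metric.closedBall (x i) r)) :
    score K m x η ≤ hitCount x (Finset.range (m + 1)) D / m := by
  have hη' : r < knnDist K x (Finset.Ioc m (2 * m)) η := by
    rwa [← not_le, knnDist_le_iff hr (hK.trans_eq (card_Ioc_two_mul m).symm), not_le]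
  rw [score_eq_hitCount_div]
  gcongr
  refine hitCount_le_hitCount fun i hi hle => by_contra fun hiD => ?_
  exact (hη'.trans_le hle).not_ge ((knnDist_range_erase_le_iff hr hK hi).2 (hD i hi hiD))

lemma hitCount_div_le_score (hr : 0 ≤ r) (hK : K ≤ m)
    (hη : K ≤ hitCount x (Finset.Ioc m (2 * m)) (Metric.closedBall η r))
    (hD : ∀ i ∈ Finset.range (m + 1), x i ∈ D →
      hitCount x ((Finset.range (m + 1)).erase i) (Metric.closedBall (x i) r) < K) :
    hitCount x (Finset.range (m + 1)) D / m ≤ score K m x η := by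
  have hη' : knnDist K x (Finset.Ioc m (2 * m)) η ≤ r :=
    (knnDist_le_iff hr (hK.trans_eq (card_Ioc_two_mul m).symm)).2 hη
  rw [score_eq_hitCount_div]
  gcongr
  refine hitCount_le_hitCount fun i hi hiD => hη'.trans (le_of_not_ge fun hle => ?_)
  exact (hD i hi hiD).not_ge ((knnDist_range_erase_le_iff hr hK hi).1 hle)

end Score

section ScoreBounds

lemma measurableSet_mem_closedBall {E : Type*} [PseudoMetricSpace E] [SecondCountableTopology E]
    [MeasurableSpace E] [OpensMeasurableSpace E] (r : ℝ) :
    MeasurableSet {p : E × E | p.2 ∈ Metric.closedBall p.1 r} :=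
  measurableSet_le (measurable_snd.dist measurable_fst) measurable_const

lemma measurable_measureReal_closedBall {E : Type*} [PseudoMetricSpace E]
    [SecondCountableTopology E] [MeasurableSpace E] [OpensMeasurableSpace E] (P : Measure E)
    [SFinite P] (r : ℝ) : Measurable fun x => P.real (Metric.closedBall x r) :=
  (measurable_measure_prodMk_left (measurableSet_mem_closedBall r)).ennreal_toReal

lemma eventually_natCast_pos_of_log_isLittleO {k : ℕ → ℕ}
    (hk : (fun m : ℕ => Real.log m) =o[atTop] fun m => (k m : ℝ)) :
    ∀ᶠ m in atTop, 0 < (k m : ℝ) := by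
  filter_upwards [hk.bound one_pos, eventually_gt_atTop 1] with m hm hm1
  refine (Nat.cast_nonneg _).lt_of_ne' fun hk0 => ?_
  have hlog : 0 < Real.log m := Real.log_pos (by exact_mod_cast hm1)
  exact hlog.ne' (by simpa [hk0] using hm)

lemma eventually_le_of_isLittleO {k : ℕ → ℕ}
    (hk : (fun m => (k m : ℝ)) =o[atTop] fun m : ℕ => (m : ℝ)) : ∀ᶠ m in atTop, k m ≤ m := by
  filter_upwards [hk.bound one_pos] with m hm
  simpa using hm

lemma eventually_lt_mul_of_tendsto_div {ι : Type*} {l : Filter ι} {a b : ι → ℝ} {c θ : ℝ}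
    (h : Tendsto (fun i => a i / b i) l (𝓝 c)) (hb : ∀ᶠ i in l, 0 < b i) (hc : c < θ) :
    ∀ᶠ i in l, a i < θ * b i := by
  filter_upwards [h.eventually_lt_const hc, hb] with i hi hbi using (div_lt_iff₀ hbi).1 hi

lemma eventually_mul_lt_of_tendsto_div {ι : Type*} {l : Filter ι} {a b : ι → ℝ} {c θ : ℝ}
    (h : Tendsto (fun i => a i / b i) l (𝓝 c)) (hb : ∀ᶠ i in l, 0 < b i) (hc : θ < c) :
    ∀ᶠ i in l, θ * b i < a i := by
  filter_upwards [h.eventually_const_lt hc, hb] with i hi hbi using (lt_div_iff₀ hbi).1 hi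

variable {d : ℕ} {f : EuclideanSpace ℝ (Fin d) → ℝ} {η : EuclideanSpace ℝ (Fin d)} {Ω : Type*}
  [MeasurableSpace Ω] {μ : Measure Ω} [IsProbabilityMeasure μ]
  {X : ℕ → Ω → EuclideanSpace ℝ (Fin d)} {k : ℕ → ℕ} {w t : ℝ}

lemma ae_eventually_score_lt (hd : d ≠ 0) (hf : Measurable f) (hnonneg : ∀ x, 0 ≤ f x)
    (hη : ContinuousAt f η) (hind : iIndepFun X μ) (hX : ∀ i, HasLaw (X i) (law f) μ)
    (hk : (fun m => (k m : ℝ)) =o[atTop] fun m : ℕ => (m : ℝ))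
    (hklog : (fun m : ℕ => Real.log m) =o[atTop] fun m => (k m : ℝ))
    (hw : f η < w) (ht : (law f).real {x | f x ≤ w} < t) :
    ∀ᵐ ω ∂μ, ∀ᶠ m in atTop, score (k m) m (fun i => X i ω) η < t := by
  have : IsProbabilityMeasure (law f) := (hX 0).isProbabilityMeasure_iff.1 inferInstance
  have hkpos := eventually_natCast_pos_of_log_isLittleO hklog
  obtain ⟨u, hηu, huw⟩ := exists_between hw
  have hu : 0 < u := (hnonneg η).trans_lt hηu
  obtain ⟨θ₁, hηθ₁, hθ₁⟩ := exists_between ((div_lt_one hu).2 hηu)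
  obtain ⟨θ₂, hθ₂, hθ₂w⟩ := exists_between ((one_lt_div hu).2 huw)
  obtain ⟨r, hr, hmass⟩ := exists_radius_tendsto_mul_measureReal_div hd hk hkpos hu
  let D : ℕ → Set (EuclideanSpace ℝ (Fin d)) :=
    fun m => {x | m * (law f).real (Metric.closedBall x (r m)) < θ₂ * k m}
  have hD : ∀ m, MeasurableSet (D m) := fun m =>
    measurableSet_lt ((measurable_measureReal_closedBall _ _).const_mul _) measurable_const
  have hDfreq : (law f).real {x | ∃ᶠ m in atTop, x ∈ D m} < t := by
    refine (ENNReal.toReal_mono (measure_ne_top _ _) (measure_mono_ae ?_)).trans_lt ht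
    filter_upwards [ae_hasBallDensityAt_law hf] with x hx hfreq
    refine le_of_not_gt fun hxw => ?_
    have hlt : θ₂ < f x / u := hθ₂w.trans_le (div_le_div_of_nonneg_right hxw.le hu.le)
    exact hfreq ((eventually_mul_lt_of_tendsto_div (hmass _ _ _ hx) hkpos hlt).mono
      fun m hm => not_lt.2 hm.le)
  have hηmass : ∀ᶠ m in atTop, (Finset.Ioc m (2 * m)).card
      * (law f).real (Metric.closedBall η (r m)) ≤ θ₁ * k m := by
    simp only [card_Ioc_two_mul]
    exact (eventually_lt_mul_of_tendsto_div (hmass _ _ _ <|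
      hasBallDensityAt_law_of_continuousAt hf hnonneg hη) hkpos hηθ₁).mono fun m hm => hm.le
  filter_upwards [ae_eventually_hitCount_lt hind hX hklog
      (fun m => Metric.isClosed_closedBall.measurableSet)
      ((div_nonneg (hnonneg η) hu.le).trans_lt hηθ₁) hθ₁ hηmass,
    ae_eventually_forall_le_hitCount hind hX hklog (S := fun m x => Metric.closedBall x (r m))
      (fun m => measurableSet_mem_closedBall (r m)) hθ₂,
    ae_eventually_hitCount_div_lt hind hX hD hDfreq] with ω hηω hballω hfreqω
  filter_upwards [hηω, hballω, hfreqω, eventually_le_of_isLittleO hk] with m hηm hballm hfreqm hkm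
  exact (score_le_hitCount_div (hr m) hkm hηm fun i hi hiD =>
    hballm i hi (not_lt.1 hiD)).trans_lt hfreqm

lemma ae_eventually_lt_score (hd : d ≠ 0) (hf : Measurable f) (hnonneg : ∀ x, 0 ≤ f x)
    (hη : ContinuousAt f η) (hind : iIndepFun X μ) (hX : ∀ i, HasLaw (X i) (law f) μ)
    (hk : (fun m => (k m : ℝ)) =o[atTop] fun m : ℕ => (m : ℝ))
    (hklog : (fun m : ℕ => Real.log m) =o[atTop] fun m => (k m : ℝ))
    (hw0 : 0 ≤ w) (hw : w < f η) (ht : t < (law f).real {x | f x ≤ w}) :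
    ∀ᵐ ω ∂μ, ∀ᶠ m in atTop, t < score (k m) m (fun i => X i ω) η := by
  have : IsProbabilityMeasure (law f) := (hX 0).isProbabilityMeasure_iff.1 inferInstance
  have hkpos := eventually_natCast_pos_of_log_isLittleO hklog
  obtain ⟨u, hwu, huη⟩ := exists_between hw
  have hu : 0 < u := hw0.trans_lt hwu
  obtain ⟨θ₁, hθ₁, hηθ₁⟩ := exists_between ((one_lt_div hu).2 huη)
  obtain ⟨θ₂, hwθ₂, hθ₂⟩ := exists_between ((div_lt_one hu).2 hwu)
  obtain ⟨r, hr, hmass⟩ := exists_radius_tendsto_mul_measureReal_div hd hk hkpos hu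
  let D : ℕ → Set (EuclideanSpace ℝ (Fin d)) :=
    fun m => {x | m * (law f).real (Metric.closedBall x (r m)) ≤ θ₂ * k m}
  have hD : ∀ m, MeasurableSet (D m) := fun m =>
    measurableSet_le ((measurable_measureReal_closedBall _ _).const_mul _) measurable_const
  have hDev : t < (law f).real {x | ∀ᶠ m in atTop, x ∈ D m} := by
    refine ht.trans_le (ENNReal.toReal_mono (measure_ne_top _ _) (measure_mono_ae ?_))
    filter_upwards [ae_hasBallDensityAt_law hf] with x hx hxw
    have hlt : f x / u < θ₂ := (div_le_div_of_nonneg_right hxw hu.le).trans_lt hwθ₂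
    exact (eventually_lt_mul_of_tendsto_div (hmass _ _ _ hx) hkpos hlt).mono fun m hm => hm.le
  have hηmass : ∀ᶠ m in atTop, θ₁ * k m
      ≤ (Finset.Ioc m (2 * m)).card * (law f).real (Metric.closedBall η (r m)) := by
    simp only [card_Ioc_two_mul]
    exact (eventually_mul_lt_of_tendsto_div (hmass _ _ _ <|
      hasBallDensityAt_law_of_continuousAt hf hnonneg hη) hkpos hηθ₁).mono fun m hm => hm.le
  filter_upwards [ae_eventually_le_hitCount hind hX hklog
      (fun m => Metric.isClosed_closedBall.measurableSet) hθ₁ hηmass,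
    ae_eventually_forall_hitCount_lt hind hX hklog (S := fun m x => Metric.closedBall x (r m))
      (fun m => measurableSet_mem_closedBall (r m)) ((div_nonneg hw0 hu.le).trans_lt hwθ₂) hθ₂,
    ae_eventually_lt_hitCount_div hind hX hD hDev] with ω hηω hballω hfreqω
  filter_upwards [hηω, hballω, hfreqω, eventually_le_of_isLittleO hk] with m hηm hballm hfreqm hkm
  exact hfreqm.trans_le (hitCount_div_le_score (hr m) hkm hηm hballm)

end ScoreBounds

section Convergence

lemma continuousAt_measureReal_le {E : Type*} [MeasurableSpace E] {P : Measure E}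
    [IsFiniteMeasure P] {f : E → ℝ} (hf : Measurable f) {a : ℝ} (ha : P {x | f x = a} = 0) :
    ContinuousAt (fun w => P.real {x | f x ≤ w}) a := by
  refine (ENNReal.tendsto_toReal (measure_ne_top _ _)).comp
    (tendsto_measure_of_ae_tendsto_indicator_of_isFiniteMeasure _
      (measurableSet_le hf measurable_const) (fun w => measurableSet_le hf measurable_const) ?_)
  have hne : ∀ᵐ x ∂P, f x ≠ a := measure_eq_zero_iff_ae_notMem.1 ha
  filter_upwards [hne] with x hx
  rcases hx.lt_or_gt with hlt | hgt
  · filter_upwards [lt_mem_nhds hlt] with w hw using ⟨fun _ => hlt.le, fun _ => hw.le⟩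
  · filter_upwards [gt_mem_nhds hgt] with w hw
      using ⟨fun h => absurd h hw.not_ge, fun h => absurd h hgt.not_ge⟩

lemma ae_tendsto_of_forall_ae_eventually {ι Ω : Type*} [MeasurableSpace Ω] {μ : Measure Ω}
    {l : Filter ι} {a : ι → Ω → ℝ} {p : ℝ} (hlt : ∀ t < p, ∀ᵐ ω ∂μ, ∀ᶠ m in l, t < a m ω)
    (hgt : ∀ t > p, ∀ᵐ ω ∂μ, ∀ᶠ m in l, a m ω < t) :
    ∀ᵐ ω ∂μ, Tendsto (fun m => a m ω) l (𝓝 p) := by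
  have hlt' : ∀ᵐ ω ∂μ, ∀ q : ℚ, (q : ℝ) < p → ∀ᶠ m in l, q < a m ω :=
    ae_all_iff.2 fun q => eventually_imp_distrib_left.2 fun hq => hlt q hq
  have hgt' : ∀ᵐ ω ∂μ, ∀ q : ℚ, p < q → ∀ᶠ m in l, a m ω < q :=
    ae_all_iff.2 fun q => eventually_imp_distrib_left.2 fun hq => hgt q hq
  filter_upwards [hlt', hgt'] with ω hω hω'
  refine tendsto_order.2 ⟨fun t ht => ?_, fun t ht => ?_⟩
  · obtain ⟨q, htq, hqp⟩ := exists_rat_btwn ht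
    exact (hω q hqp).mono fun m hm => htq.trans hm
  · obtain ⟨q, hpq, hqt⟩ := exists_rat_btwn ht
    exact (hω' q hpq).mono fun m hm => hm.trans hqt

variable {d : ℕ} {f : EuclideanSpace ℝ (Fin d) → ℝ} {η : EuclideanSpace ℝ (Fin d)}

lemma dimension_ne_zero_of_measure_eq_zero {P : Measure (EuclideanSpace ℝ (Fin d))} [NeZero P]
    (h : P {x | f x = f η} = 0) : d ≠ 0 := by
  rintro rfl
  have huniv : {x | f x = f η} = Set.univ :=
    Set.eq_univ_of_forall fun x => congrArg f (Subsingleton.elim x η)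
  exact NeZero.ne P (Measure.measure_univ_eq_zero.1 (huniv ▸ h))

lemma ae_tendsto_score {Ω : Type*} [MeasurableSpace Ω] {μ : Measure Ω} [IsProbabilityMeasure μ]
    (hf : Measurable f) (hnonneg : ∀ x, 0 ≤ f x) (hη : ContinuousAt f η)
    (hlevel : law f {x | f x = f η} = 0) {X : ℕ → Ω → EuclideanSpace ℝ (Fin d)}
    (hind : iIndepFun X μ) (hX : ∀ i, HasLaw (X i) (law f) μ) {k : ℕ → ℕ}
    (hk : (fun m => (k m : ℝ)) =o[atTop] fun m : ℕ => (m : ℝ))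
    (hklog : (fun m : ℕ => Real.log m) =o[atTop] fun m => (k m : ℝ)) :
    ∀ᵐ ω ∂μ, Tendsto (fun m => score (k m) m (fun i => X i ω) η) atTop
      (𝓝 ((law f).real {x | f x ≤ f η})) := by
  have : IsProbabilityMeasure (law f) := (hX 0).isProbabilityMeasure_iff.1 inferInstance
  have hd : d ≠ 0 := dimension_ne_zero_of_measure_eq_zero hlevel
  have hcont := continuousAt_measureReal_le hf hlevel
  refine ae_tendsto_of_forall_ae_eventually (fun t ht => ?_) fun t ht => ?_
  · rcases (hnonneg η).eq_or_lt with h0 | hpos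
    · have hzero : (law f).real {x | f x ≤ f η} = 0 := by
        rw [measureReal_def, measure_eq_zero_iff_ae_notMem.2 ?_, ENNReal.toReal_zero]
        filter_upwards [ae_law_pos hf] with x hx using not_le.2 (h0 ▸ hx)
      exact Eventually.of_forall fun ω => Eventually.of_forall fun m =>
        (hzero ▸ ht).trans_le (score_nonneg _ _ _ _)
    · obtain ⟨w, ⟨hw0, htw⟩, hw⟩ := (((lt_mem_nhds hpos).and
        (hcont.eventually_const_lt ht)).filter_mono nhdsWithin_le_nhds).and
        (self_mem_nhdsWithin (s := Set.Iio (f η))) |>.exists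
      exact ae_eventually_lt_score hd hf hnonneg hη hind hX hk hklog hw0.le hw htw
  · obtain ⟨w, htw, hw⟩ := ((hcont.eventually_lt_const ht).filter_mono nhdsWithin_le_nhds).and
      (self_mem_nhdsWithin (s := Set.Ioi (f η))) |>.exists
    exact ae_eventually_score_lt hd hf hnonneg hη hind hX hk hklog hw htw

end Convergence

section PValue

variable {d : ℕ} {f₀ f₁ : EuclideanSpace ℝ (Fin d) → ℝ} {x η : EuclideanSpace ℝ (Fin d)}

lemma likelihoodRatio_le_likelihoodRatio_iff (hη : 0 ≤ f₀ η) (hf₁ : 0 < f₁ η)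
    (hconst : f₁ x = f₁ η) :
    likelihoodRatio f₁ f₀ η ≤ likelihoodRatio f₁ f₀ x ↔ f₀ x ≤ f₀ η := by
  rw [likelihoodRatio, likelihoodRatio, hconst, div_eq_mul_inv, div_eq_mul_inv,
    ENNReal.mul_le_mul_iff_right (ENNReal.ofReal_pos.2 hf₁).ne' ENNReal.ofReal_ne_top,
    ENNReal.inv_le_inv, ENNReal.ofReal_le_ofReal_iff hη]

lemma likelihoodRatio_eq_likelihoodRatio_iff (hx : 0 ≤ f₀ x) (hη : 0 ≤ f₀ η) (hf₁ : 0 < f₁ η)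
    (hconst : f₁ x = f₁ η) :
    likelihoodRatio f₁ f₀ x = likelihoodRatio f₁ f₀ η ↔ f₀ x = f₀ η := by
  rw [le_antisymm_iff, likelihoodRatio_le_likelihoodRatio_iff hη hf₁ hconst,
    likelihoodRatio_le_likelihoodRatio_iff hx (hconst ▸ hf₁) hconst.symm, and_comm,
    ← le_antisymm_iff]

variable (hf₀ : Measurable f₀) (hη : 0 ≤ f₀ η) (hf₁ : 0 < f₁ η)
  (hconst : ∀ x ∈ Function.support f₀, f₁ x = f₁ η)

include hf₀ hη hf₁ hconst

lemma pValue_eq_measureReal_le : pValue f₁ f₀ η = (law f₀).real {x | f₀ x ≤ f₀ η} := by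
  refine measureReal_congr (eventuallyEq_set.2 ?_)
  filter_upwards [ae_law_pos hf₀] with x hx
  exact likelihoodRatio_le_likelihoodRatio_iff hη hf₁ (hconst x hx.ne')

lemma law_levelSet_eq_law_likelihoodRatio_levelSet :
    law f₀ {x | f₀ x = f₀ η}
      = law f₀ {x | likelihoodRatio f₁ f₀ x = likelihoodRatio f₁ f₀ η} := by
  refine measure_congr (eventuallyEq_set.2 ?_)
  filter_upwards [ae_law_pos hf₀] with x hx
  exact (likelihoodRatio_eq_likelihoodRatio_iff hx.le hη hf₁ (hconst x hx.ne')).symm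

end PValue

section Hypotheses

lemma uniformDensity_of_mem {d : ℕ} {x : EuclideanSpace ℝ (Fin d)} (hx : x ∈ cube d) :
    uniformDensity d x = 1 :=
  Set.indicator_of_mem hx _

lemma uniformDensity_pos {d : ℕ} {x : EuclideanSpace ℝ (Fin d)} (hx : x ∈ cube d) :
    0 < uniformDensity d x := by
  rw [uniformDensity_of_mem hx]
  exact one_pos

lemma IsCubeDensity.uniformDensity_eq {d : ℕ} {f : EuclideanSpace ℝ (Fin d) → ℝ}
    (hf : IsCubeDensity f) {η : EuclideanSpace ℝ (Fin d)} (hη : η ∈ cube d) :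
    ∀ x ∈ Function.support f, uniformDensity d x = uniformDensity d η := fun x hx => by
  have hxcube : x ∈ cube d := by_contra fun h => hx (hf.eq_zero_of_notMem x h)
  rw [uniformDensity_of_mem hxcube, uniformDensity_of_mem hη]

lemma continuousAt_of_notMem_frontier_support {α β : Type*} [TopologicalSpace α]
    [TopologicalSpace β] [Zero β] {f : α → β} {x : α}
    (hf : ContinuousOn f (interior (Function.support f)))
    (hx : x ∉ frontier (Function.support f)) : ContinuousAt f x := by
  by_cases hmem : x ∈ interior (Function.support f)
  · exact hf.continuousAt (isOpen_interior.mem_nhds hmem)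
  · have hzero : f =ᶠ[𝓝 x] 0 :=
      notMem_tsupport_iff_eventuallyEq.1 fun hclosure => hx ⟨hclosure, hmem⟩
    exact (continuousAt_const (y := 0)).congr hzero.symm

variable {k : ℕ → ℕ} {a : ℝ}

lemma natCast_isLittleO_of_isTheta_rpow
    (hk : (fun m => (k m : ℝ)) =Θ[atTop] fun m : ℕ => (m : ℝ) ^ a) (ha : a < 1) :
    (fun m => (k m : ℝ)) =o[atTop] fun m : ℕ => (m : ℝ) := by
  refine hk.trans_isLittleO (isLittleO_of_tendsto' ?_ ?_)
  · filter_upwards [eventually_ne_atTop 0] with m hm hm0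
    exact absurd hm0 (Nat.cast_ne_zero.2 hm)
  · refine ((tendsto_rpow_neg_atTop (sub_pos.2 ha)).comp tendsto_natCast_atTop_atTop).congr' ?_
    filter_upwards [eventually_ne_atTop 0] with m hm
    rw [Function.comp_apply, neg_sub, Real.rpow_sub_one (Nat.cast_ne_zero.2 hm)]

lemma log_isLittleO_of_isTheta_rpow
    (hk : (fun m => (k m : ℝ)) =Θ[atTop] fun m : ℕ => (m : ℝ) ^ a) (ha : 0 < a) :
    (fun m : ℕ => Real.log m) =o[atTop] fun m => (k m : ℝ) :=
  ((isLittleO_log_rpow_atTop ha).comp_tendsto tendsto_natCast_atTop_atTop).trans_isTheta hk.symm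

end Hypotheses

end LPE

theorem theorem2_general {d : ℕ} {Ω : Type*} [MeasurableSpace Ω] (μ : Measure Ω)
    [IsProbabilityMeasure μ] {f₀ f₁ : EuclideanSpace ℝ (Fin d) → ℝ} (hf₀ : Measurable f₀)
    (hnonneg : ∀ x, 0 ≤ f₀ x) {η : EuclideanSpace ℝ (Fin d)} (hη : ContinuousAt f₀ η)
    (hf₁ : 0 < f₁ η) (hconst : ∀ x ∈ Function.support f₀, f₁ x = f₁ η)
    (hflat : LPE.law f₀ {x | LPE.likelihoodRatio f₁ f₀ x = LPE.likelihoodRatio f₁ f₀ η} = 0)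
    {X : ℕ → Ω → EuclideanSpace ℝ (Fin d)} (hindep : iIndepFun X μ)
    (hlaw : ∀ i, HasLaw (X i) (LPE.law f₀) μ) {K : ℕ → ℕ}
    (hK : (fun m => (K m : ℝ)) =o[atTop] fun m : ℕ => (m : ℝ))
    (hKlog : (fun m : ℕ => Real.log m) =o[atTop] fun m => (K m : ℝ)) :
    ∀ᵐ ω ∂μ, Tendsto (fun m : ℕ => |LPE.score (K m) m (fun i => X i ω) η - LPE.pValue f₁ f₀ η|)
      atTop (𝓝 0) := by
  rw [← LPE.law_levelSet_eq_law_likelihoodRatio_levelSet hf₀ (hnonneg η) hf₁ hconst] at hflat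
  rw [LPE.pValue_eq_measureReal_le hf₀ (hnonneg η) hf₁ hconst]
  filter_upwards [LPE.ae_tendsto_score hf₀ hnonneg hη hflat hindep hlaw hK hKlog] with ω hω
  simpa only [Real.norm_eq_abs] using tendsto_iff_norm_sub_tendsto_zero.1 hω

theorem theorem2 {d : ℕ} {Ω : Type*} [MeasurableSpace Ω] (μ : Measure Ω) [IsProbabilityMeasure μ]
    (f₀ : EuclideanSpace ℝ (Fin d) → ℝ) (hf₀ : LPE.IsCubeDensity f₀)
    (hflat : LPE.NoFlatSpots (LPE.uniformDensity d) f₀)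
    (lamM : ℝ) (hH : LPE.HessianDominatedOn f₀ (interior (Function.support f₀)) lamM)
    (β : ℝ) (hβ : 0 < β) (hlow : ∀ x ∈ Function.support f₀, β ≤ f₀ x)
    (X : ℕ → Ω → EuclideanSpace ℝ (Fin d))
    (hindep : iIndepFun X μ) (hlaw : ∀ i, HasLaw (X i) (LPE.law f₀) μ)
    (K : ℕ → ℕ)
    (hK : (fun m => (K m : ℝ)) =Θ[atTop] fun m : ℕ => (m : ℝ) ^ (2 / 5 : ℝ)) :
    ∀ η ∈ LPE.cube d, η ∉ frontier (Function.support f₀) →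
      ∀ᵐ ω ∂μ, Tendsto
        (fun m : ℕ => |LPE.score (K m) m (fun i => X i ω) η
          - LPE.pValue (LPE.uniformDensity d) f₀ η|)
        atTop (𝓝 0) := fun _η hη hηA =>
  theorem2_general μ hf₀.measurable hf₀.nonneg
    (LPE.continuousAt_of_notMem_frontier_support hH.1.continuousOn hηA)
    (LPE.uniformDensity_pos hη) (hf₀.uniformDensity_eq hη) (hflat _) hindep hlaw
    (LPE.natCast_isLittleO_of_isTheta_rpow hK (by norm_num))
    (LPE.log_isLittleO_of_isTheta_rpow hK (by norm_num))
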